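/- Let $n\ge 1$ and let $\delta_n=(n-1,n-2,\dots,2,1)$. A partition $\mu=(\mu_1\ge\mu_2\ge\cdots)$ (possibly empty) is identified with the set of positions $(i,j)$, $1\le j\le\mu_i$, and containment of partitions is containment of these sets. For a partition $\mu\subseteq\delta_n$ let $M^\mu$ be the $n\times n$ matrix with entry $1$ at $(1,\mu_1+1)$, with entries $1$ at $(k+1,\mu_{k+1}+1)$ and $-1$ at $(k+1,\mu_k+1)$ for each $1\le k\le n-1$ with $\mu_k>\mu_{k+1}$, and with all other entries $0$. For a partition $\lambda\subseteq\delta_n$ let $\mathrm{PASM}(\delta_n/\lambda,n,n)\subset\mathbb{R}^{n\times n}$ be the convex hull of the matrices $M^\mu$ with $\lambda\subseteq\mu\subseteq\delta_n$. An alternating sign matrix is an $n\times n$ matrix with entries in $\{-1,0,1\}$ such that $\sum_{i'=1}^{i}M_{i'j}\in\{0,1\}$ and $\sum_{j'=1}^{j}M_{ij'}\in\{0,1\}$ for all $1\le i,j\le n$, and such that every row and every column sums to $1$. Let $\mathrm{ASM}(n)\subset\mathbb{R}^{n\times n}$ be the convex hull of the alternating sign matrices, and let $$\mathrm{ASMCRY}(\lambda,n)=\{A\in\mathrm{ASM}(n)\;:\;A_{ij}=0\text{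 whenever } i+j\ge n+3\text{ or }(i,j)\in\lambda\}.$$ An integer polytope is the convex hull of a finite set of integer points. An integral equivalence from an integer polytope $P\subset\mathbb{R}^d$ to an integer polytope $Q\subset\mathbb{R}^r$ is an affine map $f:\mathbb{R}^d\to\mathbb{R}^r$ that maps $P$ bijectively onto $Q$ and maps $\mathbb{Z}^d\cap\mathrm{aff}(P)$ bijectively onto $\mathbb{Z}^r\cap\mathrm{aff}(Q)$, where $\mathrm{aff}$ denotes the affine span. **Theorem.** For every $n\ge1$ and every partition $\lambda\subseteq\delta_n$, both $\mathrm{PASM}(\delta_n/\lambda,n,n)$ and $\mathrm{ASMCRY}(\lambda,n)$ are integer polytopes, and the translation $\varphi:\mathbb{R}^{n\times n}\to\mathbb{R}^{n\times n}$ given by $$\varphi(M)_{ij}=\begin{cases}M_{ij}+1&\text{if } j=n-i+2,\\ M_{ij}&\text{otherwise}\end{cases}$$ is an integral equivalence from $\mathrm{PASM}(\delta_n/\lambda,n,n)$ to $\mathrm{ASMCRY}(\lambda,n)$. -/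

import Mathlib

/- Partitions are Mathlib's Young diagrams (English convention, boxes indexed from zero): the part
`μ_{i+1}` is `μ.rowLen i`, the box in row `i+1` and column `j+1` is `(i, j) ∈ μ`, and containment of
partitions is `≤`. Rows and columns of matrices are likewise indexed from zero by `Fin`. -/

/-- The staircase partition `δ_n = (n-1, n-2, …, 2, 1)`: the boxes `(i, j)` with `i + j + 2 ≤ n`
(zero-based). -/
def staircase (n : ℕ) : YoungDiagram where
  cells := (Finset.range n ×ˢ Finset.range n).filter fun c => c.1 + c.2 + 2 ≤ n
  isLowerSet := by
    rintro ⟨a, b⟩ ⟨c, d⟩ h hab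
    obtain ⟨h1, h2⟩ : c ≤ a ∧ d ≤ b := h
    simp only [Finset.coe_filter, Finset.mem_product, Finset.mem_range, Set.mem_ofPred_eq] at hab ⊢
    omega

theorem mem_staircase {n i j : ℕ} : (i, j) ∈ staircase n ↔ i + j + 2 ≤ n := by
  rw [← YoungDiagram.mem_cells]
  simp only [staircase, Finset.mem_filter, Finset.mem_product, Finset.mem_range]
  omega

/-- The `m × n` matrix `M^μ(m, n)` of a partition `μ` contained in `(n-1)^(m-1)`. With one-based
indices: `1` at `(1, μ_1 + 1)`; whenever `1 ≤ k ≤ m - 1` and `μ_k > μ_{k+1}`, `1` at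
`(k+1, μ_{k+1} + 1)` and `-1` at `(k+1, μ_k + 1)`; all other entries `0`. -/
noncomputable def partitionMatrix (μ : YoungDiagram) (m n : ℕ) : Matrix (Fin m) (Fin n) ℝ :=
  Matrix.of fun i j =>
    if (i : ℕ) = 0 ∧ (j : ℕ) = μ.rowLen 0 then 1
    else if 1 ≤ (i : ℕ) ∧ (j : ℕ) = μ.rowLen i ∧ μ.rowLen i < μ.rowLen (i - 1) then 1
    else if 1 ≤ (i : ℕ) ∧ (j : ℕ) = μ.rowLen (i - 1) ∧ μ.rowLen i < μ.rowLen (i - 1) then -1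
    else 0

/-- The `(ν/lam)`-partial ASM polytope `PASM(ν/lam, m, n)`, for `lam ⊆ ν ⊆ (n-1)^(m-1)`. -/
noncomputable def PASMPolytope (ν lam : YoungDiagram) (m n : ℕ) : Set (Matrix (Fin m) (Fin n) ℝ) :=
  convexHull ℝ {M | ∃ μ : YoungDiagram, lam ≤ μ ∧ μ ≤ ν ∧ M = partitionMatrix μ m n}

/-- Alternating sign matrices, as real matrices. -/
structure IsASM {n : ℕ} (M : Matrix (Fin n) (Fin n) ℝ) : Prop where
  entry : ∀ i j, M i j ∈ ({-1, 0, 1} : Set ℝ)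
  colPartial : ∀ i j, ∑ i' ∈ Finset.Iic i, M i' j ∈ ({0, 1} : Set ℝ)
  rowPartial : ∀ i j, ∑ j' ∈ Finset.Iic j, M i j' ∈ ({0, 1} : Set ℝ)
  colSum : ∀ j, ∑ i, M i j = 1
  rowSum : ∀ i, ∑ j, M i j = 1

/-- The alternating sign matrix polytope `ASM(n)`. -/
noncomputable def ASMPolytope (n : ℕ) : Set (Matrix (Fin n) (Fin n) ℝ) :=
  convexHull ℝ {M | IsASM M}

/-- The polytope `ASMCRY(lam, n)`. The condition `i + j ≥ n + 3` on one-based indices reads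
`n + 1 ≤ i + j` on zero-based ones. -/
noncomputable def ASMCRYPolytope (lam : YoungDiagram) (n : ℕ) : Set (Matrix (Fin n) (Fin n) ℝ) :=
  {A | A ∈ ASMPolytope n ∧
    ∀ i j : Fin n, n + 1 ≤ (i : ℕ) + j ∨ ((i : ℕ), (j : ℕ)) ∈ lam → A i j = 0}

/-- The lattice of integer points in the space of real matrices. -/
def integerMatrices (m n : ℕ) : Set (Matrix (Fin m) (Fin n) ℝ) :=
  {A | ∀ i j, ∃ z : ℤ, A i j = z}

/-- Integer polytopes: convex hulls of finite sets of integer points. -/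
def IsIntegerPolytope {m n : ℕ} (P : Set (Matrix (Fin m) (Fin n) ℝ)) : Prop :=
  ∃ V : Set (Matrix (Fin m) (Fin n) ℝ), V.Finite ∧ V ⊆ integerMatrices m n ∧ P = convexHull ℝ V

/-- The affine map `f` is an integral equivalence from the integer polytope `P` to the integer
polytope `Q`: it maps `P` bijectively onto `Q`, and the integer points of the affine span of `P`
bijectively onto those of the affine span of `Q`. -/
structure IsIntegralEquivalence {m n m' n' : ℕ}
    (f : Matrix (Fin m) (Fin n) ℝ →ᵃ[ℝ] Matrix (Fin m') (Fin n') ℝ)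
    (P : Set (Matrix (Fin m) (Fin n) ℝ)) (Q : Set (Matrix (Fin m') (Fin n') ℝ)) : Prop where
  source_integer : IsIntegerPolytope P
  target_integer : IsIntegerPolytope Q
  bijOn : Set.BijOn f P Q
  bijOn_lattice : Set.BijOn f
    (integerMatrices m n ∩ (affineSpan ℝ P : Set (Matrix (Fin m) (Fin n) ℝ)))
    (integerMatrices m' n' ∩ (affineSpan ℝ Q : Set (Matrix (Fin m') (Fin n') ℝ)))

/-- The translation `φ` adding `1` to the entries with `j = n - i + 2` (one-based indices; on
zero-based ones this is `i + j = n`) and leaving all other entries unchanged. -/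
noncomputable def antidiagonalTranslation (n : ℕ) :
    Matrix (Fin n) (Fin n) ℝ →ᵃ[ℝ] Matrix (Fin n) (Fin n) ℝ where
  toFun M := Matrix.of fun i j => if (i : ℕ) + j = n then M i j + 1 else M i j
  linear := LinearMap.id
  map_vadd' M v := by
    ext i j
    simp only [Matrix.of_apply, vadd_eq_add, Matrix.add_apply, LinearMap.id_apply]
    split_ifs <;> ring

/-! A matrix is encoded by its corner sums, and its entries are their mixed second differences. The
corner sums of `partitionMatrix μ` are the indicator of the complement of `μ`; translating adds the
positive part of `a + b - 1 - n`. The total climbs by 0 or 1 at each unit step and has the boundary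
values of an alternating sign matrix, which gives one inclusion (`translated_partitionMatrix_mem`).

Conversely, for `A` in `ASMCRYPolytope lam n` the vanishing entries and the line sums force the
corner sum `a + b - n` wherever `a + b > n` (`cornerSum_of_vanishing`). On the staircase the corner
sums `g` increase in both directions, lie in `[0, 1]` and vanish on `lam`. So each `{g < t}` with `t
> 0` is a partition between `lam` and the staircase, and `g = ∫₀¹ 1[t ≤ g] dt` exhibits the
translate of `A` back as an average of partition matrices (`ASMCRYPolytope_subset`). -/

open MeasureTheory in
/-- The entrywise average over `(0, 1]` of a family of arrays from a finite set lies in the convex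
hull of that set. -/
theorem integral_mem_convexHull_of_finite {m n : ℕ} {s : Set (Fin m → Fin n → ℝ)} (hs : s.Finite)
    {f : ℝ → Fin m → Fin n → ℝ} (hf : ∀ t, 0 < t → f t ∈ s)
    (hint : ∀ i j, Integrable (fun t => f t i j) (volume.restrict (Set.Ioc (0 : ℝ) 1))) :
    (fun i j => ∫ t in Set.Ioc (0 : ℝ) 1, f t i j) ∈ convexHull ℝ s := by
  have : IsProbabilityMeasure (volume.restrict (Set.Ioc (0 : ℝ) 1)) := ⟨by simp⟩
  have hrow : ∀ i, Integrable (fun t => f t i) (volume.restrict (Set.Ioc (0 : ℝ) 1)) :=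
    fun i => Integrable.of_eval (hint i)
  have hall : Integrable f (volume.restrict (Set.Ioc (0 : ℝ) 1)) := Integrable.of_eval hrow
  -- A mean stays in a closed convex set; finiteness of `s` supplies closedness.
  have h := (convex_convexHull ℝ s).integral_mem (hs.isClosed_convexHull ℝ)
    (ae_restrict_of_forall_mem measurableSet_Ioc
      fun t ht => subset_convexHull ℝ s (hf t ht.1)) hall
  convert h using 1
  ext i j
  rw [eval_integral hrow, eval_integral (hint i)]

/-! ### Corner sums and their differences -/

/-- The sum of the entries of `A` in the first `a` rows and the first `b` columns. -/
noncomputable def cornerSum {n : ℕ} (A : Matrix (Fin n) (Fin n) ℝ) (a b : ℕ) : ℝ :=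
  ∑ i : Fin n, ∑ j : Fin n, if (i : ℕ) < a ∧ (j : ℕ) < b then A i j else 0

theorem cornerSum_zero_left {n : ℕ} (A : Matrix (Fin n) (Fin n) ℝ) (b : ℕ) :
    cornerSum A 0 b = 0 := by simp [cornerSum]

theorem cornerSum_zero_right {n : ℕ} (A : Matrix (Fin n) (Fin n) ℝ) (a : ℕ) :
    cornerSum A a 0 = 0 := by simp [cornerSum]

theorem cornerSum_transpose {n : ℕ} (A : Matrix (Fin n) (Fin n) ℝ) (a b : ℕ) :
    cornerSum A.transpose a b = cornerSum A b a := by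
  unfold cornerSum
  rw [Finset.sum_comm]
  simp [and_comm]

theorem cornerSum_succ_left {n : ℕ} (A : Matrix (Fin n) (Fin n) ℝ) (i : Fin n) (b : ℕ) :
    cornerSum A (i + 1) b = cornerSum A i b + ∑ j : Fin n, if (j : ℕ) < b then A i j else 0 := by
  unfold cornerSum
  have h : ∀ i' : Fin n, (∑ j : Fin n, if (i' : ℕ) < i + 1 ∧ (j : ℕ) < b then A i' j else 0) =
      (∑ j : Fin n, if (i' : ℕ) < i ∧ (j : ℕ) < b then A i' j else 0) +
        if i' = i then (∑ j : Fin n, if (j : ℕ) < b then A i j else 0) else 0 := by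
    intro i'
    by_cases h : i' = i
    · subst h; simp
    · have h' : (i' : ℕ) ≠ i := fun e => h (Fin.ext e)
      have : (i' : ℕ) < i + 1 ↔ (i' : ℕ) < i := by omega
      simp [h, this]
  rw [Finset.sum_congr rfl fun i' _ => h i', Finset.sum_add_distrib]
  simp

theorem sum_ite_lt_succ {n : ℕ} (f : Fin n → ℝ) (j : Fin n) :
    (∑ j' : Fin n, if (j' : ℕ) < j + 1 then f j' else 0) =
      (∑ j' : Fin n, if (j' : ℕ) < j then f j' else 0) + f j := by
  have h : ∀ j' : Fin n, (if (j' : ℕ) < j + 1 then f j' else 0) =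
      (if (j' : ℕ) < j then f j' else 0) + if j' = j then f j' else 0 := by
    intro j'
    by_cases h : j' = j
    · subst h; simp
    · have h' : (j' : ℕ) ≠ j := fun e => h (Fin.ext e)
      have : (j' : ℕ) < j + 1 ↔ (j' : ℕ) < j := by omega
      simp [h, this]
  rw [Finset.sum_congr rfl fun i' _ => h i', Finset.sum_add_distrib]
  simp

theorem entry_eq_cornerSum {n : ℕ} (A : Matrix (Fin n) (Fin n) ℝ) (i j : Fin n) :
    A i j = cornerSum A (i + 1) (j + 1) - cornerSum A i (j + 1)
      - cornerSum A (i + 1) j + cornerSum A i j := by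
  rw [cornerSum_succ_left, cornerSum_succ_left, sum_ite_lt_succ]
  ring

theorem sum_Iic_eq_sum_ite {n : ℕ} (f : Fin n → ℝ) (j : Fin n) :
    ∑ j' ∈ Finset.Iic j, f j' = ∑ j' : Fin n, if (j' : ℕ) < j + 1 then f j' else 0 := by
  rw [← Finset.sum_filter]
  congr 1
  ext j'
  simp only [Finset.mem_Iic, Finset.mem_filter, Finset.mem_univ, true_and, Fin.le_def]
  omega

theorem sum_Iic_sub {n : ℕ} (F : ℕ → ℝ) (j : Fin n) :
    ∑ j' ∈ Finset.Iic j, (F (j' + 1) - F j') = F (j + 1) - F 0 := by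
  rw [sum_Iic_eq_sum_ite, Fin.sum_univ_eq_sum_range
    (fun k => if k < (j : ℕ) + 1 then F (k + 1) - F k else 0), ← Finset.sum_filter,
    ← Finset.sum_range_sub F]
  congr 1
  ext k
  simp only [Finset.mem_filter, Finset.mem_range]
  omega

theorem sum_univ_sub {n : ℕ} (F : ℕ → ℝ) :
    ∑ j : Fin n, (F (j + 1) - F j) = F n - F 0 := by
  rw [Fin.sum_univ_eq_sum_range (fun k => F (k + 1) - F k), Finset.sum_range_sub]

/-! ### Corner sums of partition matrices and of the antidiagonal -/

open Classical in
/-- The corner sums of `partitionMatrix μ`: the indicator of the boxes outside `μ`. -/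
noncomputable def outsideIndicator (μ : YoungDiagram) (a b : ℕ) : ℝ :=
  if 0 < a ∧ 0 < b ∧ (a - 1, b - 1) ∉ μ then 1 else 0

/-- Below the top row, the difference of the indicators of two consecutive rows is the indicator of
the columns from `μ.rowLen i` up to, but excluding, `μ.rowLen (i - 1)`. Differencing along the row
leaves `1` at its start and `-1` just past its end, or nothing if the interval is empty. -/
theorem partitionMatrix_apply (μ : YoungDiagram) {m n : ℕ} (i : Fin m) (j : Fin n) :
    partitionMatrix μ m n i j = outsideIndicator μ (i + 1) (j + 1) - outsideIndicator μ i (j + 1)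
      - outsideIndicator μ (i + 1) j + outsideIndicator μ i j := by
  simp only [partitionMatrix, Matrix.of_apply, outsideIndicator, YoungDiagram.mem_iff_lt_rowLen,
    not_lt, Nat.add_sub_cancel]
  obtain ⟨i, hi⟩ := i
  obtain ⟨j, hj⟩ := j
  rcases i with _ | i
  · generalize μ.rowLen 0 = x
    simp only [true_and, lt_irrefl, false_and, if_false, zero_lt_one, zero_add,
      show ¬ (1 : ℕ) ≤ 0 by omega]
    rcases j with _ | j <;> split_ifs <;> first | (exfalso; omega) | norm_num
  · have hle : μ.rowLen (i + 1) ≤ μ.rowLen i := μ.rowLen_anti _ _ (Nat.le_succ i)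
    simp only [Nat.add_sub_cancel, Nat.succ_ne_zero, false_and, if_false]
    generalize μ.rowLen (i + 1) = x at *
    generalize μ.rowLen i = y at *
    rcases j with _ | j <;> split_ifs <;> first | (exfalso; omega) | norm_num

/-- The corner sums of the matrix with ones at the positions `i + j = n` (zero-based). -/
noncomputable def antidiagonalCorner (n a b : ℕ) : ℝ := ((a + b - 1 - n : ℕ) : ℝ)

/-- Truncated subtraction makes `antidiagonalCorner` a positive part: piecewise linear in `a + b`,
so its second difference sees only the kink. -/
theorem antidiagonal_entry {n : ℕ} (i j : Fin n) :
    (if (i : ℕ) + j = n then (1 : ℝ) else 0) =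
      antidiagonalCorner n (i + 1) (j + 1) - antidiagonalCorner n i (j + 1)
      - antidiagonalCorner n (i + 1) j + antidiagonalCorner n i j := by
  obtain ⟨i, hi⟩ := i
  obtain ⟨j, hj⟩ := j
  simp only [antidiagonalCorner]
  rcases lt_trichotomy (i + j) n with h | h | h
  · rw [if_neg h.ne]
    rw [show i + 1 + (j + 1) - 1 - n = 0 by omega, show i + (j + 1) - 1 - n = 0 by omega,
      show i + 1 + j - 1 - n = 0 by omega, show i + j - 1 - n = 0 by omega]
    norm_num
  · rw [if_pos h]
    rw [show i + 1 + (j + 1) - 1 - n = 1 by omega, show i + (j + 1) - 1 - n = 0 by omega,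
      show i + 1 + j - 1 - n = 0 by omega, show i + j - 1 - n = 0 by omega]
    norm_num
  · obtain ⟨k, hk⟩ := Nat.exists_eq_add_of_lt h
    rw [if_neg h.ne']
    rw [show i + 1 + (j + 1) - 1 - n = k + 2 by omega, show i + (j + 1) - 1 - n = k + 1 by omega,
      show i + 1 + j - 1 - n = k + 1 by omega, show i + j - 1 - n = k by omega]
    push_cast
    ring

theorem antidiagonalTranslation_apply {n : ℕ} (M : Matrix (Fin n) (Fin n) ℝ) (i j : Fin n) :
    antidiagonalTranslation n M i j = M i j + if (i : ℕ) + j = n then 1 else 0 := by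
  change (if (i : ℕ) + j = n then M i j + 1 else M i j) = _
  split_ifs <;> simp

theorem translated_partitionMatrix_apply (μ : YoungDiagram) {n : ℕ} (i j : Fin n) :
    antidiagonalTranslation n (partitionMatrix μ n n) i j =
      (outsideIndicator μ (i + 1) (j + 1) + antidiagonalCorner n (i + 1) (j + 1))
      - (outsideIndicator μ i (j + 1) + antidiagonalCorner n i (j + 1))
      - (outsideIndicator μ (i + 1) j + antidiagonalCorner n (i + 1) j)
      + (outsideIndicator μ i j + antidiagonalCorner n i j) := by
  rw [antidiagonalTranslation_apply, partitionMatrix_apply, antidiagonal_entry]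
  ring

/-! ### Translated partition matrices lie in ASMCRY -/

theorem outsideIndicator_transpose (μ : YoungDiagram) (a b : ℕ) :
    outsideIndicator μ.transpose a b = outsideIndicator μ b a := by
  simp only [outsideIndicator, YoungDiagram.mem_transpose, Prod.swap]
  congr 1
  rw [eq_iff_iff]
  tauto

theorem antidiagonalCorner_comm (n a b : ℕ) :
    antidiagonalCorner n a b = antidiagonalCorner n b a := by
  simp only [antidiagonalCorner, add_comm]

theorem transpose_le_staircase {μ : YoungDiagram} {n : ℕ} (h : μ ≤ staircase n) :
    μ.transpose ≤ staircase n := by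
  rintro ⟨i, j⟩ hij
  have h1 : (j, i) ∈ μ := by simpa using hij
  have := mem_staircase.1 (h h1)
  exact mem_staircase.2 (by omega)

theorem outsideIndicator_eq_one {μ : YoungDiagram} {n a b : ℕ} (h : μ ≤ staircase n)
    (ha : 0 < a) (hb : 0 < b) (hab : n < a + b) : outsideIndicator μ a b = 1 := by
  rw [outsideIndicator, if_pos]
  refine ⟨ha, hb, fun hmem => ?_⟩
  have := mem_staircase.1 (h hmem)
  omega

theorem outsideIndicator_zero_left (μ : YoungDiagram) (b : ℕ) : outsideIndicator μ 0 b = 0 := by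
  simp [outsideIndicator]

theorem outsideIndicator_zero_right (μ : YoungDiagram) (a : ℕ) : outsideIndicator μ a 0 = 0 := by
  simp [outsideIndicator]

theorem outsideIndicator_step (μ : YoungDiagram) (a b : ℕ) :
    outsideIndicator μ (a + 1) b - outsideIndicator μ a b ∈ ({0, 1} : Set ℝ) := by
  have key : (a, b - 1) ∈ μ → (a - 1, b - 1) ∈ μ := fun h => μ.up_left_mem (by omega) le_rfl h
  simp only [outsideIndicator, Nat.add_sub_cancel]
  by_cases h1 : (a, b - 1) ∈ μ
  · simp [h1, key h1]
  · by_cases hb : 0 < b <;> by_cases h2 : 0 < a ∧ (a - 1, b - 1) ∉ μ <;> simp_all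

/-- The two summands never climb together: for `a + b ≤ n` the antidiagonal term is still zero, and
beyond that the indicator is already constantly `1`. -/
theorem translated_corner_step {μ : YoungDiagram} {n : ℕ} (h : μ ≤ staircase n) {a b : ℕ}
    (ha : a < n) (hb : b ≤ n) :
    (outsideIndicator μ (a + 1) b + antidiagonalCorner n (a + 1) b)
      - (outsideIndicator μ a b + antidiagonalCorner n a b) ∈ ({0, 1} : Set ℝ) := by
  by_cases hab : n < a + b
  · right
    obtain ⟨k, hk⟩ := Nat.exists_eq_add_of_lt hab
    have h0 : 0 < a := by omega
    rw [outsideIndicator_eq_one h (by omega) (by omega) (by omega),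
      outsideIndicator_eq_one h h0 (by omega) hab, antidiagonalCorner, antidiagonalCorner,
      show a + 1 + b - 1 - n = k + 1 by omega, show a + b - 1 - n = k by omega]
    push_cast
    simp
  · rw [antidiagonalCorner, antidiagonalCorner,
      show a + 1 + b - 1 - n = 0 by omega, show a + b - 1 - n = 0 by omega]
    simpa using outsideIndicator_step μ a b

theorem translated_corner_step_right {μ : YoungDiagram} {n : ℕ} (h : μ ≤ staircase n) {a b : ℕ}
    (ha : a ≤ n) (hb : b < n) :
    (outsideIndicator μ a (b + 1) + antidiagonalCorner n a (b + 1))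
      - (outsideIndicator μ a b + antidiagonalCorner n a b) ∈ ({0, 1} : Set ℝ) := by
  have := translated_corner_step (transpose_le_staircase h) hb ha
  simpa only [outsideIndicator_transpose, antidiagonalCorner_comm n _ a] using this

/-- Partial row and column sums telescope to unit steps of `H`, because `H` vanishes on the axes;
the full sums are `1` because `H n b = b` and `H a n = a`. -/
theorem isASM_translated_partitionMatrix {n : ℕ} (hn : 0 < n) {μ : YoungDiagram}
    (h : μ ≤ staircase n) : IsASM (antidiagonalTranslation n (partitionMatrix μ n n)) := by
  set H : ℕ → ℕ → ℝ := fun a b => outsideIndicator μ a b + antidiagonalCorner n a b with hH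
  have hentry : ∀ i j : Fin n, antidiagonalTranslation n (partitionMatrix μ n n) i j =
      H (i + 1) (j + 1) - H i (j + 1) - H (i + 1) j + H i j :=
    translated_partitionMatrix_apply μ
  have hcol : ∀ i j : Fin n, H (i + 1) (j + 1) - H (i + 1) j ∈ ({0, 1} : Set ℝ) :=
    fun i j => translated_corner_step_right h i.2 j.2
  have hrow : ∀ i j : Fin n, H (i + 1) (j + 1) - H i (j + 1) ∈ ({0, 1} : Set ℝ) :=
    fun i j => translated_corner_step h i.2 j.2
  have hrow' : ∀ i j : Fin n, H (i + 1) j - H i j ∈ ({0, 1} : Set ℝ) :=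
    fun i j => translated_corner_step h i.2 j.2.le
  have h0l : ∀ b, b ≤ n → H 0 b = 0 := fun b hb => by
    simp [hH, outsideIndicator_zero_left, antidiagonalCorner, show b - 1 - n = 0 by omega]
  have h0r : ∀ a, a ≤ n → H a 0 = 0 := fun a ha => by
    simp [hH, outsideIndicator_zero_right, antidiagonalCorner, show a - 1 - n = 0 by omega]
  have hnl : ∀ b, b ≤ n → H n b = b := fun b hb => by
    rcases Nat.eq_zero_or_pos b with rfl | hb0
    · simpa using h0r n le_rfl
    · simp only [hH, outsideIndicator_eq_one h hn hb0 (by omega), antidiagonalCorner]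
      rw [show n + b - 1 - n = b - 1 by omega, Nat.cast_sub hb0]
      simp
  have hnr : ∀ a, a ≤ n → H a n = a := fun a ha => by
    rcases Nat.eq_zero_or_pos a with rfl | ha0
    · simpa using h0l n le_rfl
    · simp only [hH, outsideIndicator_eq_one h ha0 hn (by omega), antidiagonalCorner]
      rw [show a + n - 1 - n = a - 1 by omega, Nat.cast_sub ha0]
      simp
  refine ⟨fun i j => ?_, fun i j => ?_, fun i j => ?_, fun j => ?_, fun i => ?_⟩
  · have h1 := hrow i j
    have h2 := hrow' i j
    simp only [Set.mem_insert_iff, Set.mem_singleton_iff] at h1 h2 ⊢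
    rw [hentry]
    rcases h1 with h1 | h1 <;> rcases h2 with h2 | h2
    · right; left; linarith
    · left; linarith
    · right; right; linarith
    · right; left; linarith
  · have := sum_Iic_sub (fun a => H a (j + 1) - H a j) i
    rw [h0l _ j.2, h0l _ j.2.le] at this
    rw [Finset.sum_congr rfl fun i' _ => (hentry i' j).trans
      (show _ = (H (i' + 1) (j + 1) - H (i' + 1) j) - (H i' (j + 1) - H i' j) by ring), this]
    simpa using hcol i j
  · have := sum_Iic_sub (fun b => H (i + 1) b - H i b) j
    rw [h0r _ i.2, h0r _ i.2.le] at this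
    rw [Finset.sum_congr rfl fun j' _ => (hentry i j').trans
      (show _ = (H (i + 1) (j' + 1) - H i (j' + 1)) - (H (i + 1) j' - H i j') by ring), this]
    simpa using hrow i j
  · have := sum_univ_sub (n := n) (fun a => H a (j + 1) - H a j)
    rw [h0l _ j.2, h0l _ j.2.le, hnl _ j.2, hnl _ j.2.le] at this
    rw [Finset.sum_congr rfl fun i' _ => (hentry i' j).trans
      (show _ = (H (i' + 1) (j + 1) - H (i' + 1) j) - (H i' (j + 1) - H i' j) by ring), this]
    push_cast
    ring
  · have := sum_univ_sub (n := n) (fun b => H (i + 1) b - H i b)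
    rw [h0r _ i.2, h0r _ i.2.le, hnr _ i.2, hnr _ i.2.le] at this
    rw [Finset.sum_congr rfl fun j' _ => (hentry i j').trans
      (show _ = (H (i + 1) (j' + 1) - H i (j' + 1)) - (H (i + 1) j' - H i j') by ring), this]
    push_cast
    ring

theorem outsideIndicator_eq_zero {μ : YoungDiagram} {a b : ℕ} (h : (a - 1, b - 1) ∈ μ) :
    outsideIndicator μ a b = 0 := by
  rw [outsideIndicator, if_neg]
  tauto

theorem translated_partitionMatrix_mem {n : ℕ} (hn : 0 < n) {lam μ : YoungDiagram} (hl : lam ≤ μ)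
    (h : μ ≤ staircase n) :
    antidiagonalTranslation n (partitionMatrix μ n n) ∈ ASMCRYPolytope lam n := by
  refine ⟨subset_convexHull ℝ _ (isASM_translated_partitionMatrix hn h), fun i j hij => ?_⟩
  rw [antidiagonalTranslation_apply, partitionMatrix_apply]
  rcases hij with hij | hij
  -- All four corners of the entry lie outside `μ`; in the other case all four have indicator `0`.
  · rw [if_neg (by omega), outsideIndicator_eq_one h (by omega) (by omega) (by omega),
      outsideIndicator_eq_one h (by omega) (by omega) (by omega),
      outsideIndicator_eq_one h (by omega) (by omega) (by omega),
      outsideIndicator_eq_one h (by omega) (by omega) (by omega)]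
    norm_num
  · have hmem := hl hij
    have hle := mem_staircase.1 (h hmem)
    rw [if_neg (by omega), outsideIndicator_eq_zero, outsideIndicator_eq_zero,
      outsideIndicator_eq_zero, outsideIndicator_eq_zero]
    · norm_num
    all_goals exact μ.up_left_mem (by omega) (by omega) hmem

/-! ### Constraints on the corner sums of a point of ASMCRY -/

theorem convex_ASMCRYPolytope (lam : YoungDiagram) (n : ℕ) : Convex ℝ (ASMCRYPolytope lam n) := by
  intro A hA B hB a b ha hb hab
  refine ⟨convex_convexHull ℝ _ hA.1 hB.1 ha hb hab, fun i j hij => ?_⟩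
  simp [hA.2 i j hij, hB.2 i j hij]

/-- The linear inequalities satisfied by the points of `ASM(n)` that are used below. -/
theorem ASMPolytope_inequalities {n : ℕ} {A : Matrix (Fin n) (Fin n) ℝ} (hA : A ∈ ASMPolytope n) :
    (∀ i j, 0 ≤ ∑ i' ∈ Finset.Iic i, A i' j) ∧ (∀ i j, 0 ≤ ∑ j' ∈ Finset.Iic j, A i j') ∧
      (∀ j, ∑ i, A i j = 1) ∧ ∀ i, ∑ j, A i j = 1 := by
  have hnonneg : ∀ x ∈ ({0, 1} : Set ℝ), 0 ≤ x := by
    rintro x (rfl | rfl) <;> norm_num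
  refine convexHull_min (t := {A : Matrix (Fin n) (Fin n) ℝ |
    (∀ i j, 0 ≤ ∑ i' ∈ Finset.Iic i, A i' j) ∧ (∀ i j, 0 ≤ ∑ j' ∈ Finset.Iic j, A i j') ∧
      (∀ j, ∑ i, A i j = 1) ∧ ∀ i, ∑ j, A i j = 1}) ?_ ?_ hA
  · intro M hM
    exact ⟨fun i j => hnonneg _ (hM.colPartial i j), fun i j => hnonneg _ (hM.rowPartial i j),
      hM.colSum, hM.rowSum⟩
  · rintro A ⟨a1, a2, a3, a4⟩ B ⟨b1, b2, b3, b4⟩ a b ha hb hab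
    refine ⟨fun i j => ?_, fun i j => ?_, fun j => ?_, fun i => ?_⟩ <;>
      simp only [Matrix.add_apply, Matrix.smul_apply, smul_eq_mul, Finset.sum_add_distrib,
        ← Finset.mul_sum]
    · exact add_nonneg (mul_nonneg ha (a1 i j)) (mul_nonneg hb (b1 i j))
    · exact add_nonneg (mul_nonneg ha (a2 i j)) (mul_nonneg hb (b2 i j))
    · rw [a3, b3]; linarith
    · rw [a4, b4]; linarith

theorem cornerSum_mono_left {n : ℕ} {A : Matrix (Fin n) (Fin n) ℝ}
    (h : ∀ i j, 0 ≤ ∑ j' ∈ Finset.Iic j, A i j') {a a' b : ℕ} (haa : a ≤ a') (ha : a' ≤ n)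
    (hb : b ≤ n) : cornerSum A a b ≤ cornerSum A a' b := by
  induction a', haa using Nat.le_induction with
  | base => exact le_rfl
  | succ a' haa ih =>
    refine (ih (by omega)).trans ?_
    have := cornerSum_succ_left A ⟨a', ha⟩ b
    simp only at this
    rw [this]
    rcases b with _ | b
    · simp
    · have h1 := h ⟨a', ha⟩ ⟨b, hb⟩
      rw [sum_Iic_eq_sum_ite] at h1
      simpa using h1

theorem cornerSum_mono_right {n : ℕ} {A : Matrix (Fin n) (Fin n) ℝ}
    (h : ∀ i j, 0 ≤ ∑ i' ∈ Finset.Iic i, A i' j) {a b b' : ℕ} (hbb : b ≤ b') (hb : b' ≤ n)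
    (ha : a ≤ n) : cornerSum A a b ≤ cornerSum A a b' := by
  rw [← cornerSum_transpose A b, ← cornerSum_transpose A b']
  exact cornerSum_mono_left (fun i j => h j i) hbb hb ha

theorem cornerSum_full_right {n : ℕ} {A : Matrix (Fin n) (Fin n) ℝ} (h : ∀ i, ∑ j, A i j = 1)
    {a : ℕ} (ha : a ≤ n) : cornerSum A a n = a := by
  induction a with
  | zero => simp [cornerSum_zero_left]
  | succ a ih =>
    have := cornerSum_succ_left A ⟨a, ha⟩ n
    simp only [Fin.is_lt, if_true, h] at this
    rw [this, ih (by omega)]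
    push_cast
    rfl

theorem cornerSum_full_left {n : ℕ} {A : Matrix (Fin n) (Fin n) ℝ} (h : ∀ j, ∑ i, A i j = 1)
    {b : ℕ} (hb : b ≤ n) : cornerSum A n b = b := by
  rw [← cornerSum_transpose]
  exact cornerSum_full_right h hb

/-- Induction inward from the last row and column, where line sums fix the values. A vanishing entry
makes the fourth corner a linear function of the other three; `k` is the distance of `a + b` from `2
* n`. -/
theorem cornerSum_of_vanishing {n : ℕ} {A : Matrix (Fin n) (Fin n) ℝ}
    (hc : ∀ j, ∑ i, A i j = 1) (hr : ∀ i, ∑ j, A i j = 1)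
    (hz : ∀ i j : Fin n, n + 1 ≤ (i : ℕ) + j → A i j = 0) (k : ℕ) :
    ∀ a b : ℕ, a ≤ n → b ≤ n → n < a + b → a + b + k = 2 * n →
      cornerSum A a b = (a : ℝ) + b - n := by
  induction k using Nat.strong_induction_on with
  | _ k ih =>
    intro a b ha hb hab hk
    rcases ha.eq_or_lt with rfl | ha'
    · rw [cornerSum_full_left hc hb]; ring
    rcases hb.eq_or_lt with rfl | hb'
    · rw [cornerSum_full_right hr ha]; ring
    have h := entry_eq_cornerSum A ⟨a, ha'⟩ ⟨b, hb'⟩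
    rw [hz _ _ (show n + 1 ≤ a + b by omega)] at h
    simp only at h
    rw [ih (k - 2) (by omega) (a + 1) (b + 1) (by omega) (by omega) (by omega) (by omega),
      ih (k - 1) (by omega) a (b + 1) (by omega) (by omega) (by omega) (by omega),
      ih (k - 1) (by omega) (a + 1) b (by omega) (by omega) (by omega) (by omega)] at h
    push_cast at h
    linarith

/-! ### Layer-cake decomposition into partition matrices -/

open Classical in
/-- The partition inside the staircase cut out by the condition `g (i + 1) (j + 1) < t`. -/
noncomputable def sublevelDiagram (n : ℕ) (g : ℕ → ℕ → ℝ)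
    (hg : ∀ {i j i' j' : ℕ}, i' ≤ i → j' ≤ j → i + j + 2 ≤ n →
      g (i' + 1) (j' + 1) ≤ g (i + 1) (j + 1)) (t : ℝ) : YoungDiagram where
  cells := (staircase n).cells.filter fun c => g (c.1 + 1) (c.2 + 1) < t
  isLowerSet := by
    rintro ⟨a, b⟩ ⟨c, d⟩ h hab
    obtain ⟨h1, h2⟩ : c ≤ a ∧ d ≤ b := h
    simp only [Finset.mem_coe, Finset.mem_filter, YoungDiagram.mem_cells, mem_staircase] at hab ⊢
    exact ⟨by omega, (hg h1 h2 hab.1).trans_lt hab.2⟩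

theorem mem_sublevelDiagram {n : ℕ} {g : ℕ → ℕ → ℝ}
    {hg : ∀ {i j i' j' : ℕ}, i' ≤ i → j' ≤ j → i + j + 2 ≤ n →
      g (i' + 1) (j' + 1) ≤ g (i + 1) (j + 1)} {t : ℝ} {i j : ℕ} :
    (i, j) ∈ sublevelDiagram n g hg t ↔ i + j + 2 ≤ n ∧ g (i + 1) (j + 1) < t := by
  rw [← YoungDiagram.mem_cells]
  simp [sublevelDiagram, mem_staircase]

theorem finite_partitionMatrices (ν lam : YoungDiagram) (m n : ℕ) :
    {M | ∃ μ : YoungDiagram, lam ≤ μ ∧ μ ≤ ν ∧ M = partitionMatrix μ m n}.Finite := by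
  have h : {μ : YoungDiagram | μ ≤ ν}.Finite := by
    refine Set.Finite.of_finite_image (f := YoungDiagram.cells) ?_ ?_
    · refine (Finset.finite_toSet ν.cells.powerset).subset ?_
      rintro _ ⟨μ, hμ, rfl⟩
      simpa using hμ
    · intro μ _ μ' _ he
      exact YoungDiagram.ext he
  refine (h.image fun μ => partitionMatrix μ m n).subset ?_
  rintro _ ⟨μ, _, hμ, rfl⟩
  exact ⟨μ, hμ, rfl⟩

open MeasureTheory in
theorem integrable_and_integral_threshold {x : ℝ} (h0 : 0 ≤ x) (h1 : x ≤ 1) :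
    Integrable (fun t => if t ≤ x then (1 : ℝ) else 0) (volume.restrict (Set.Ioc (0 : ℝ) 1)) ∧
      ∫ t in Set.Ioc (0 : ℝ) 1, (if t ≤ x then (1 : ℝ) else 0) = x := by
  have he : (fun t => if t ≤ x then (1 : ℝ) else 0) = (Set.Iic x).indicator fun _ => 1 := by
    ext t; simp [Set.indicator_apply]
  rw [he]
  refine ⟨(integrable_const 1).indicator measurableSet_Iic, ?_⟩
  rw [integral_indicator measurableSet_Iic, Measure.restrict_restrict measurableSet_Iic,
    Set.inter_comm, Set.Ioc_inter_Iic, min_eq_right h1]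
  simp [h0]

-- The preimage of `A` is the average over `t` in `(0, 1]` of the matrices of the sublevel
-- partitions of its corner sums.
open MeasureTheory in
theorem ASMCRYPolytope_subset {n : ℕ} {lam : YoungDiagram} (hlam : lam ≤ staircase n) :
    ASMCRYPolytope lam n ⊆ antidiagonalTranslation n '' PASMPolytope (staircase n) lam n n := by
  rintro A ⟨hA, hz⟩
  obtain ⟨hcp, hrp, hc, hr⟩ := ASMPolytope_inequalities hA
  have hval : ∀ {a b : ℕ}, a ≤ n → b ≤ n → n < a + b → cornerSum A a b = (a : ℝ) + b - n :=
    fun {a b} ha hb hab => cornerSum_of_vanishing hc hr (fun i j hij => hz i j (Or.inl hij))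
      (2 * n - a - b) a b ha hb hab (by omega)
  have hmono : ∀ {i j i' j' : ℕ}, i' ≤ i → j' ≤ j → i + j + 2 ≤ n →
      cornerSum A (i' + 1) (j' + 1) ≤ cornerSum A (i + 1) (j + 1) := fun h1 h2 h3 =>
    (cornerSum_mono_left hrp (by omega) (by omega) (by omega)).trans
      (cornerSum_mono_right hcp (by omega) (by omega) (by omega))
  have hpos : ∀ {a b : ℕ}, a ≤ n → b ≤ n → 0 ≤ cornerSum A a b := fun {a b} ha hb => by
    rw [← cornerSum_zero_left A b]
    exact cornerSum_mono_left hrp (Nat.zero_le _) ha hb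
  have hle : ∀ {a b : ℕ}, a + b ≤ n → cornerSum A a b ≤ 1 := fun {a b} hab => by
    rcases Nat.eq_zero_or_pos b with rfl | hb
    · rw [cornerSum_zero_right]; exact zero_le_one
    -- Row `n + 1 - b` is the first in which the corner sum is forced, and there it equals `1`.
    · refine (cornerSum_mono_left hrp (a' := n + 1 - b) (by omega) (by omega) (by omega)).trans ?_
      rw [hval (by omega) (by omega) (by omega), Nat.cast_sub (by omega)]
      push_cast
      linarith
  have hlam0 : ∀ {i j : ℕ}, (i, j) ∈ lam → cornerSum A (i + 1) (j + 1) = 0 := fun {i j} hij => by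
    unfold cornerSum
    refine Finset.sum_eq_zero fun i' _ => Finset.sum_eq_zero fun j' _ => ?_
    split_ifs with h
    · exact hz i' j' (Or.inr (lam.up_left_mem (by omega) (by omega) hij))
    · rfl
  have hD : ∀ a b : ℕ, a ≤ n → b ≤ n →
      Integrable (fun t => outsideIndicator (sublevelDiagram n (cornerSum A) hmono t) a b)
        (volume.restrict (Set.Ioc (0 : ℝ) 1)) ∧
      ∫ t in Set.Ioc (0 : ℝ) 1, outsideIndicator (sublevelDiagram n (cornerSum A) hmono t) a b =
        cornerSum A a b - antidiagonalCorner n a b := by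
    intro a b ha hb
    rcases Nat.eq_zero_or_pos a with rfl | ha0
    · simp [outsideIndicator_zero_left, cornerSum_zero_left, antidiagonalCorner,
        show b - 1 - n = 0 by omega]
    rcases Nat.eq_zero_or_pos b with rfl | hb0
    · simp [outsideIndicator_zero_right, cornerSum_zero_right, antidiagonalCorner,
        show a - 1 - n = 0 by omega]
    by_cases hab : n < a + b
    · have h1 : ∀ t, outsideIndicator (sublevelDiagram n (cornerSum A) hmono t) a b = 1 :=
        fun t => outsideIndicator_eq_one (n := n)
          (fun c hc => mem_staircase.2 (mem_sublevelDiagram.1 hc).1) ha0 hb0 hab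
      simp only [h1]
      refine ⟨integrable_const _, ?_⟩
      rw [hval ha hb hab, antidiagonalCorner, Nat.cast_sub (by omega), Nat.cast_sub (by omega)]
      simp
    · have h1 : ∀ t, outsideIndicator (sublevelDiagram n (cornerSum A) hmono t) a b =
          if t ≤ cornerSum A a b then 1 else 0 := by
        intro t
        obtain ⟨a, rfl⟩ := Nat.exists_eq_succ_of_ne_zero ha0.ne'
        obtain ⟨b, rfl⟩ := Nat.exists_eq_succ_of_ne_zero hb0.ne'
        have : a + b + 2 ≤ n := by omega
        simp [outsideIndicator, mem_sublevelDiagram, this]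
      simp only [h1]
      rw [antidiagonalCorner, show a + b - 1 - n = 0 by omega, Nat.cast_zero, sub_zero]
      exact integrable_and_integral_threshold (hpos ha hb) (hle (by omega))
  -- Corner sums are zero on `lam`, so the strict sublevel set contains it only for positive `t`;
  -- hence the half-open interval.
  have hmem : ∀ t : ℝ, 0 < t → lam ≤ sublevelDiagram n (cornerSum A) hmono t := by
    rintro t ht ⟨i, j⟩ hij
    exact mem_sublevelDiagram.2 ⟨mem_staircase.1 (hlam hij), by rw [hlam0 hij]; exact ht⟩
  have hentry : ∀ i j : Fin n,
      Integrable (fun t => partitionMatrix (sublevelDiagram n (cornerSum A) hmono t) n n i j)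
        (volume.restrict (Set.Ioc (0 : ℝ) 1)) ∧
      ∫ t in Set.Ioc (0 : ℝ) 1, partitionMatrix (sublevelDiagram n (cornerSum A) hmono t) n n i j =
        A i j - if (i : ℕ) + j = n then 1 else 0 := by
    intro i j
    obtain ⟨i1, e1⟩ := hD (i + 1) (j + 1) i.2 j.2
    obtain ⟨i2, e2⟩ := hD i (j + 1) i.2.le j.2
    obtain ⟨i3, e3⟩ := hD (i + 1) j i.2 j.2.le
    obtain ⟨i4, e4⟩ := hD i j i.2.le j.2.le
    simp only [partitionMatrix_apply]
    refine ⟨((i1.sub i2).sub i3).add i4, ?_⟩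
    rw [integral_add (by exact (i1.sub i2).sub i3) i4, integral_sub (by exact i1.sub i2) i3,
      integral_sub i1 i2,
      e1, e2, e3, e4, antidiagonal_entry, entry_eq_cornerSum A i j]
    ring
  refine ⟨Matrix.of fun i j => A i j - if (i : ℕ) + j = n then 1 else 0, ?_, ?_⟩
  · have h := integral_mem_convexHull_of_finite
      (finite_partitionMatrices (staircase n) lam n n)
      (f := fun t => partitionMatrix (sublevelDiagram n (cornerSum A) hmono t) n n)
      (fun t ht => ⟨_, hmem t ht, fun c hc => mem_staircase.2 (mem_sublevelDiagram.1 hc).1, rfl⟩)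
      (fun i j => (hentry i j).1)
    simp only [fun i j => (hentry i j).2] at h
    exact h
  · ext i j
    rw [antidiagonalTranslation_apply, Matrix.of_apply, sub_add_cancel]

/-! ### The integral equivalence -/

theorem image_PASMPolytope {n : ℕ} (hn : 0 < n) {lam : YoungDiagram} (hlam : lam ≤ staircase n) :
    antidiagonalTranslation n '' PASMPolytope (staircase n) lam n n = ASMCRYPolytope lam n := by
  refine Set.Subset.antisymm ?_ (ASMCRYPolytope_subset hlam)
  rw [PASMPolytope, AffineMap.image_convexHull]
  refine convexHull_min ?_ (convex_ASMCRYPolytope lam n)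
  rintro _ ⟨_, ⟨μ, hl, hs, rfl⟩, rfl⟩
  exact translated_partitionMatrix_mem hn hl hs

theorem antidiagonalTranslation_injective (n : ℕ) :
    Function.Injective (antidiagonalTranslation n) := by
  intro A B h
  ext i j
  have := congrFun (congrFun h i) j
  rw [antidiagonalTranslation_apply, antidiagonalTranslation_apply] at this
  exact add_right_cancel this

theorem antidiagonalTranslation_mem_integerMatrices {n : ℕ} {M : Matrix (Fin n) (Fin n) ℝ} :
    antidiagonalTranslation n M ∈ integerMatrices n n ↔ M ∈ integerMatrices n n := by
  refine forall₂_congr fun i j => ?_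
  rw [antidiagonalTranslation_apply]
  split_ifs
  · exact ⟨fun ⟨z, hz⟩ => ⟨z - 1, by push_cast; linarith⟩,
      fun ⟨z, hz⟩ => ⟨z + 1, by push_cast; linarith⟩⟩
  · rw [add_zero]

theorem partitionMatrix_mem_integerMatrices (μ : YoungDiagram) (m n : ℕ) :
    partitionMatrix μ m n ∈ integerMatrices m n := by
  intro i j
  simp only [partitionMatrix, Matrix.of_apply]
  split_ifs
  exacts [⟨1, by simp⟩, ⟨1, by simp⟩, ⟨-1, by simp⟩, ⟨0, by simp⟩]

theorem mainTheorem6 (n : ℕ) (hn : 0 < n) (lam : YoungDiagram) (hlam : lam ≤ staircase n) :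
    IsIntegralEquivalence (antidiagonalTranslation n)
      (PASMPolytope (staircase n) lam n n) (ASMCRYPolytope lam n) := by
  have himage := image_PASMPolytope hn hlam
  have hinj := antidiagonalTranslation_injective n
  refine ⟨⟨_, finite_partitionMatrices _ _ n n, ?_, rfl⟩,
    ⟨_, (finite_partitionMatrices (staircase n) lam n n).image (antidiagonalTranslation n), ?_, ?_⟩,
    ?_, ?_⟩
  · rintro _ ⟨μ, _, _, rfl⟩
    exact partitionMatrix_mem_integerMatrices μ n n
  · rintro _ ⟨_, ⟨μ, _, _, rfl⟩, rfl⟩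
    exact antidiagonalTranslation_mem_integerMatrices.2 (partitionMatrix_mem_integerMatrices μ n n)
  · rw [← himage, PASMPolytope, AffineMap.image_convexHull]
  · rw [← himage]
    exact hinj.injOn.bijOn_image
  -- Affine maps commute with affine spans, and this translation is by an integer matrix, so it
  -- preserves integrality both ways.
  · rw [← himage, ← AffineSubspace.map_span]
    refine ⟨?_, hinj.injOn, ?_⟩
    · rintro M ⟨hM, hM'⟩
      exact ⟨antidiagonalTranslation_mem_integerMatrices.2 hM, M, hM', rfl⟩
    · rintro _ ⟨hM, M, hM', rfl⟩
      exact ⟨M, ⟨antidiagonalTranslation_mem_integerMatrices.1 hM, hM'⟩, rfl⟩
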